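/- **Setup.** Let $N=\{1,\dots,n\}$ be the receivers, $\Omega=\{X,Y\}$ the states, $\lambda^0$ a strictly positive common prior on $\Omega$, and $S_i$ a countably infinite set of messages for each receiver $i$; put $S=\prod_{i\in N}S_i$. An experiment $\pi$ gives, for each state $\omega$, a finitely supported probability distribution $\pi(\cdot\mid\omega)$ on $S$; let $S^\pi$ be the set of signals sent with positive probability in some state. In an undirected (simple) network $g$ on $N$, receiver $i$ observes, upon a signal $s\in S^\pi$, exactly the messages of itself and of its neighbors, forms by Bayes' rule the posterior probability of $X$, and takes action $x$ if this posterior is at least $\tfrac12$ and action $y$ otherwise. For a critical mass $k$, the value of $\pi$ on $g$ is the probability that at least $k$ receivers take action $x$. The value of the network $g$ is the supremum of the values of all experiments on $g$, and $V^n_k$ denotes the value of the empty network on $N$. An extension of $g$ is a network on $N$ obtained from $g$ by adding one or more links; it strictly benefits the sender if its value is strictly larger than the value of $g$. A halo with $m+1$ receivers is a network with exactly $2m$ links in which some $m$ distinct receivers $k_1,\dots,k_m$ satisfy $g_{k_1k_2}=g_{k_2k_3}=\dots=g_{k_{m-1}k_m}=g_{k_mk_1}=1$ and the remaining receiver (the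 center) has degree $m$. **Statement.** Assume $k\ge\lfloor\frac{n+1}{2}\rfloor$ and $\lambda^0(X)<\frac{k}{n+k}$. Let $g$ be a network on $N$ that has a connected component which is a halo with more than $k$ and fewer than $n$ receivers, and exclude the case in which $n=5$ and this component has exactly $4$ receivers (so that $g$ is a complete network on four receivers together with one isolated receiver). Then there is an extension $g'$ of $g$ that strictly benefits the sender and whose value is $V^n_k$. -/

import Mathlib

/-!
In state `X` success can be certain, so only success in state `Y` is at stake. By Bayes' rule a
receiver takes action `x` in state `Y` at most as often as in state `X`, relative to the prior, and
`k` such actions are needed for each success: hence `V(g) ≤ λ(X) + n λ(X) / k`. This is tight if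
in state `Y` success is spread evenly over coalitions of `k` receivers, each of which is told
what it is told in state `X`.

In a component with a hub, the hub knows all that the other members know. It can be discounted
whenever the whole component of more than `k` receivers takes action `x`, so only `n - 1` of the `n`
terms count and the bound is missed.

The bound is reached on an extension of `g` in which a few links remain missing, and hence also on
the empty network, where every receiver can be sent what it observes elsewhere. Give every receiver
a partner to which it is not linked, link all other pairs, and let no coalition separate receivers
with the same partner. Hand out uniform random bits, one for every receiver and coalition, such that
the bits for a coalition that are held by the partners of its members have even sum in state `X`,
while in state `Y` this fails for exactly one random coalition. Its members do not see the bit of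
their own partner and learn nothing, whereas all others notice. In a halo component of a larger
network such partners exist: two opposite rim receivers are never linked if the rim has at least
four receivers, and receivers inside the component are not linked to those outside it.
-/

namespace NetworkPersuasion

/-- The two states of the world. -/
inductive State
  | X
  | Y

/-- The two actions of a receiver. -/
inductive Act
  | x
  | y

/-- The two outcomes. -/
inductive Outcome
  | x
  | y

/-- A signal assigns a message to every receiver. -/
abbrev Signal {N : Type*} (S : N → Type*) := (i : N) → S i

/-- An experiment: for every state, a finitely supported probability distribution on signals. -/
structure Experiment {N : Type*} (S : N → Type*) where
  prob : State → (Signal S →₀ ℝ)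
  nonneg : ∀ ω s, 0 ≤ prob ω s
  sum_eq_one : ∀ ω, ∑ s ∈ (prob ω).support, prob ω s = 1

/-- The neighborhood of a receiver, the receiver included. -/
def nbhd {N : Type*} (g : SimpleGraph N) (i : N) : Set N :=
  {j | g.Adj i j ∨ j = i}

/-- The signals that are sent with positive probability in some state. -/
def supp {N : Type*} {S : N → Type*} (π : Experiment S) : Set (Signal S) :=
  {s | ∃ ω, 0 < π.prob ω s}

open Classical in
/-- The probability of a set of signals, conditional on the state. -/
noncomputable def probOf {N : Type*} {S : N → Type*} (π : Experiment S) (ω : State)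
    (A : Set (Signal S)) : ℝ :=
  ∑ t ∈ (π.prob ω).support with t ∈ A, π.prob ω t

/-- The association set of receiver `i` at the signal `s`: the signals in the support that agree
with `s` on all messages that `i` observes. -/
def assocSet {N : Type*} {S : N → Type*} (g : SimpleGraph N) (π : Experiment S) (i : N)
    (s : Signal S) : Set (Signal S) :=
  {t | t ∈ supp π ∧ ∀ j ∈ nbhd g i, t j = s j}

/-- The posterior belief of receiver `i` at the signal `s`, by Bayes' rule. It is used only for
`s` in the support, where the denominator is positive (for a positive prior). -/
noncomputable def posterior {N : Type*} {S : N → Type*} (prior : State → ℝ) (g : SimpleGraph N)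
    (π : Experiment S) (i : N) (s : Signal S) (ω : State) : ℝ :=
  probOf π ω (assocSet g π i s) * prior ω /
    (probOf π State.X (assocSet g π i s) * prior State.X +
      probOf π State.Y (assocSet g π i s) * prior State.Y)

open Classical in
/-- The action of receiver `i` at the signal `s` (ties are broken in favor of the sender). -/
noncomputable def action {N : Type*} {S : N → Type*} (prior : State → ℝ) (g : SimpleGraph N)
    (π : Experiment S) (s : Signal S) (i : N) : Act :=
  if 1 / 2 ≤ posterior prior g π i s State.X then Act.x else Act.y

open Classical in
/-- The outcome of an action profile under the critical mass `k`. -/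
noncomputable def outcome {N : Type*} (k : ℕ) (a : N → Act) : Outcome :=
  if k ≤ {i | a i = Act.x}.ncard then Outcome.x else Outcome.y

/-- The signals in the support that achieve the critical mass. -/
def successSet {N : Type*} {S : N → Type*} (prior : State → ℝ) (k : ℕ) (g : SimpleGraph N)
    (π : Experiment S) : Set (Signal S) :=
  {s | s ∈ supp π ∧ outcome k (action prior g π s) = Outcome.x}

/-- The value of an experiment: the probability of reaching the critical mass, that is, the
expected utility of the sender. -/
noncomputable def experimentValue {N : Type*} {S : N → Type*} (prior : State → ℝ) (k : ℕ)
    (g : SimpleGraph N) (π : Experiment S) : ℝ :=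
  prior State.X * probOf π State.X (successSet prior k g π) +
    prior State.Y * probOf π State.Y (successSet prior k g π)

/-- The value of a network: the supremum of the values of all experiments. -/
noncomputable def networkValue {N : Type*} (S : N → Type*) (prior : State → ℝ) (k : ℕ)
    (g : SimpleGraph N) : ℝ :=
  ⨆ π : Experiment S, experimentValue prior k g π

/-- The private value: the value of the empty network on the same receivers. -/
noncomputable def privateValue {N : Type*} (S : N → Type*) (prior : State → ℝ) (k : ℕ) : ℝ :=
  networkValue S prior k (⊥ : SimpleGraph N)

/-- A halo: a network on `m + 1` receivers with exactly `2 * m` links, in which some `m` distinct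
receivers are linked in cyclic order and the remaining receiver has degree `m`. -/
def IsHalo {N : Type*} (g : SimpleGraph N) : Prop :=
  ∃ (m : ℕ) (c : Fin m → N) (r : N),
    Nat.card N = m + 1 ∧
    g.edgeSet.ncard = 2 * m ∧
    Function.Injective c ∧
    (∀ i, c i ≠ r) ∧
    (∀ i, g.Adj (c i) (c (finRotate m i))) ∧
    (g.neighborSet r).ncard = m

end NetworkPersuasion

namespace NetworkPersuasion

section ObedienceBound

variable {N : Type*} {S : N → Type*}

open Classical in
/-- The support of an experiment as a finite set. -/
noncomputable def suppFinset (π : Experiment S) : Finset (Signal S) :=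
  (π.prob State.X).support ∪ (π.prob State.Y).support

lemma support_subset_suppFinset (π : Experiment S) (ω : State) :
    (π.prob ω).support ⊆ suppFinset π := by
  classical
  cases ω
  · exact Finset.subset_union_left
  · exact Finset.subset_union_right

lemma mem_supp_iff {π : Experiment S} {s : Signal S} : s ∈ supp π ↔ ∃ ω, π.prob ω s ≠ 0 :=
  exists_congr fun ω => (π.nonneg ω s).lt_iff_ne.trans ne_comm

lemma mem_suppFinset {π : Experiment S} {s : Signal S} : s ∈ suppFinset π ↔ s ∈ supp π := by
  simp only [suppFinset, Finset.mem_union, Finsupp.mem_support_iff, mem_supp_iff]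
  exact ⟨fun h => h.elim (⟨_, ·⟩) (⟨_, ·⟩), fun ⟨ω, h⟩ => by cases ω <;> simp [h]⟩

open Classical in
lemma probOf_eq_sum_suppFinset (π : Experiment S) (ω : State) (A : Set (Signal S)) :
    probOf π ω A = ∑ s ∈ suppFinset π with s ∈ A, π.prob ω s := by
  refine Finset.sum_subset (Finset.filter_subset_filter _ (support_subset_suppFinset π ω)) ?_
  intro s hs hs'
  by_contra h
  exact hs' (Finset.mem_filter.2 ⟨Finsupp.mem_support_iff.2 h, (Finset.mem_filter.1 hs).2⟩)

lemma sum_suppFinset (π : Experiment S) (ω : State) : ∑ s ∈ suppFinset π, π.prob ω s = 1 := by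
  rw [← π.sum_eq_one ω]
  exact (Finset.sum_subset (support_subset_suppFinset π ω) fun s _ =>
    Finsupp.notMem_support_iff.1).symm

lemma probOf_nonneg (π : Experiment S) (ω : State) (A : Set (Signal S)) : 0 ≤ probOf π ω A :=
  Finset.sum_nonneg fun s _ => π.nonneg ω s

lemma probOf_le_one (π : Experiment S) (ω : State) (A : Set (Signal S)) : probOf π ω A ≤ 1 := by
  classical
  rw [← π.sum_eq_one ω]
  exact Finset.sum_le_sum_of_subset_of_nonneg (Finset.filter_subset _ _) fun s _ _ => π.nonneg ω s

lemma probOf_pos {π : Experiment S} {ω : State} {s : Signal S} {A : Set (Signal S)}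
    (hs : 0 < π.prob ω s) (hA : s ∈ A) : 0 < probOf π ω A := by
  classical
  exact Finset.sum_pos' (fun t _ => π.nonneg ω t)
    ⟨s, Finset.mem_filter.2 ⟨Finsupp.mem_support_iff.2 hs.ne', hA⟩, hs⟩

/-- The part of a signal that receiver `i` observes. -/
def view (g : SimpleGraph N) (i : N) (s : Signal S) : (j : nbhd g i) → S j :=
  fun j => s j

lemma view_eq_view_iff {g : SimpleGraph N} {i : N} {s t : Signal S} :
    view g i s = view g i t ↔ ∀ j ∈ nbhd g i, s j = t j :=
  funext_iff.trans Subtype.forall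

variable {prior : State → ℝ}

/-- The event that receiver `i` takes action `x`. -/
def actX (prior : State → ℝ) (g : SimpleGraph N) (π : Experiment S) (i : N) : Set (Signal S) :=
  {s | action prior g π s i = Act.x}

lemma half_le_div_add_iff {a b : ℝ} (h : 0 < a + b) : 1 / 2 ≤ a / (a + b) ↔ b ≤ a := by
  rw [div_le_div_iff₀ two_pos h]
  constructor <;> intro <;> linarith

lemma mem_actX_iff (hpos : ∀ ω, 0 < prior ω) {g : SimpleGraph N} {π : Experiment S} {i : N}
    {s : Signal S} (hs : s ∈ supp π) :
    s ∈ actX prior g π i ↔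
      prior State.Y * probOf π State.Y (assocSet g π i s) ≤
        prior State.X * probOf π State.X (assocSet g π i s) := by
  have hself : s ∈ assocSet g π i s := ⟨hs, fun _ _ => rfl⟩
  have hnonneg : ∀ ω, 0 ≤ probOf π ω (assocSet g π i s) * prior ω := fun ω =>
    mul_nonneg (probOf_nonneg π ω _) (hpos ω).le
  have htotal : 0 < probOf π State.X (assocSet g π i s) * prior State.X +
      probOf π State.Y (assocSet g π i s) * prior State.Y := by
    obtain ⟨ω, hω⟩ := hs
    have hω' := mul_pos (probOf_pos hω hself) (hpos ω)
    cases ω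
    · exact add_pos_of_pos_of_nonneg hω' (hnonneg _)
    · exact add_pos_of_nonneg_of_pos (hnonneg _) hω'
  have haction : s ∈ actX prior g π i ↔ 1 / 2 ≤ posterior prior g π i s State.X := by
    change action prior g π s i = Act.x ↔ _
    rw [action]
    split_ifs with h
    · exact iff_of_true rfl h
    · exact iff_of_false nofun h
  rw [haction, posterior, half_le_div_add_iff htotal, mul_comm (prior _), mul_comm (prior _)]

lemma assocSet_congr {g : SimpleGraph N} {π : Experiment S} {i : N} {s t : Signal S}
    (h : view g i t = view g i s) : assocSet g π i t = assocSet g π i s :=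
  Set.ext fun u => and_congr_right fun _ => forall₂_congr fun j hj => by
    rw [view_eq_view_iff.1 h j hj]

lemma mem_actX_congr {g : SimpleGraph N} {π : Experiment S} {i : N} {s t : Signal S}
    (h : view g i t = view g i s) : t ∈ actX prior g π i ↔ s ∈ actX prior g π i := by
  have hposterior : posterior prior g π i t State.X = posterior prior g π i s State.X := by
    rw [posterior, posterior, assocSet_congr h]
  change action prior g π t i = Act.x ↔ action prior g π s i = Act.x
  rw [action, action, hposterior]

lemma mem_successSet_iff {k : ℕ} {g : SimpleGraph N} {π : Experiment S} {s : Signal S} :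
    s ∈ successSet prior k g π ↔ s ∈ supp π ∧ k ≤ {i | s ∈ actX prior g π i}.ncard := by
  simp only [successSet, outcome, actX, Set.mem_ofPred_eq]
  refine and_congr_right fun _ => ?_
  split_ifs with h <;> simp [h]

open Classical in
lemma probOf_assocSet_eq_sum_filter {g : SimpleGraph N} {π : Experiment S} {i : N}
    {E : Set (Signal S)} (hview : ∀ s t, view g i t = view g i s → s ∈ E → t ∈ E)
    {s : Signal S} (hs : s ∈ E) (ω : State) :
    probOf π ω (assocSet g π i s) =
      ∑ t ∈ {t ∈ suppFinset π | t ∈ E} with view g i t = view g i s, π.prob ω t := by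
  rw [probOf_eq_sum_suppFinset, Finset.filter_filter]
  refine Finset.sum_congr (Finset.filter_congr fun t ht => ?_) fun _ _ => rfl
  exact ⟨fun h => have hv := view_eq_view_iff.2 h.2; ⟨hview s t hv hs, hv⟩,
    fun h => ⟨mem_suppFinset.1 ht, view_eq_view_iff.1 h.2⟩⟩

/-- Summing the obedience constraints over the views of receiver `i` that make up `E`. -/
lemma prior_mul_probOf_le_of_subset_actX (hpos : ∀ ω, 0 < prior ω) {g : SimpleGraph N}
    {π : Experiment S} {i : N} {E : Set (Signal S)}
    (hview : ∀ s t, view g i t = view g i s → s ∈ E → t ∈ E) (hE : E ⊆ actX prior g π i) :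
    prior State.Y * probOf π State.Y E ≤ prior State.X * probOf π State.X E := by
  classical
  have hfiber : ∀ ω, probOf π ω E =
      ∑ v ∈ {s ∈ suppFinset π | s ∈ E}.image (view g i),
        ∑ s ∈ {s ∈ suppFinset π | s ∈ E} with view g i s = v, π.prob ω s := by
    intro ω
    rw [probOf_eq_sum_suppFinset]
    exact (Finset.sum_fiberwise_of_maps_to (fun s => Finset.mem_image_of_mem (view g i)) _).symm
  rw [hfiber, hfiber, Finset.mul_sum, Finset.mul_sum]
  refine Finset.sum_le_sum fun v hv => ?_
  obtain ⟨s, hs, rfl⟩ := Finset.mem_image.1 hv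
  obtain ⟨hsupp, hsE⟩ := Finset.mem_filter.1 hs
  rw [← probOf_assocSet_eq_sum_filter hview hsE, ← probOf_assocSet_eq_sum_filter hview hsE]
  exact (mem_actX_iff hpos (mem_suppFinset.1 hsupp)).1 (hE hsE)

lemma experimentValue_nonneg (hpos : ∀ ω, 0 < prior ω) (k : ℕ) (g : SimpleGraph N)
    (π : Experiment S) : 0 ≤ experimentValue prior k g π :=
  add_nonneg (mul_nonneg (hpos _).le (probOf_nonneg ..)) (mul_nonneg (hpos _).le (probOf_nonneg ..))

lemma bddAbove_range_experimentValue (hpos : ∀ ω, 0 < prior ω) (k : ℕ) (g : SimpleGraph N) :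
    BddAbove (Set.range fun π : Experiment S => experimentValue prior k g π) := by
  refine ⟨prior State.X + prior State.Y, ?_⟩
  rintro _ ⟨π, rfl⟩
  exact add_le_add (mul_le_of_le_one_right (hpos _).le (probOf_le_one ..))
    (mul_le_of_le_one_right (hpos _).le (probOf_le_one ..))

/-- The probability of success that Bayes' rule allows if, conditional on `X`, on average at most
`M` receivers take action `x`: success is certain in state `X`, and in state `Y` every receiver can
be persuaded only as often as is compensated by state `X`. -/
noncomputable def valueBound (prior : State → ℝ) (k M : ℕ) : ℝ :=
  prior State.X + M * prior State.X / k

lemma valueBound_nonneg (hpos : ∀ ω, 0 < prior ω) (k M : ℕ) : 0 ≤ valueBound prior k M := by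
  have := hpos State.X
  rw [valueBound]
  positivity

lemma valueBound_strictMono (hpos : ∀ ω, 0 < prior ω) {k : ℕ} (hk : 0 < k) :
    StrictMono (valueBound prior k) := by
  intro M M' h
  have := hpos State.X
  unfold valueBound
  gcongr

lemma sum_probOf_eq_sum_ncard_mul [Fintype N] (π : Experiment S) (ω : State)
    (E : N → Set (Signal S)) :
    ∑ i, probOf π ω (E i) = ∑ s ∈ suppFinset π, ({i | s ∈ E i}.ncard : ℝ) * π.prob ω s := by
  classical
  simp only [probOf_eq_sum_suppFinset, Finset.sum_filter]
  rw [Finset.sum_comm]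
  refine Finset.sum_congr rfl fun s _ => ?_
  rw [← Finset.sum_filter, Finset.sum_const, nsmul_eq_mul, ← Set.ncard_coe_finset,
    Finset.coe_filter_univ]

lemma mul_probOf_le_sum_probOf [Fintype N] {π : Experiment S} {ω : State} {E : N → Set (Signal S)}
    {A : Set (Signal S)} {k : ℕ} (h : ∀ s ∈ A, k ≤ {i | s ∈ E i}.ncard) :
    k * probOf π ω A ≤ ∑ i, probOf π ω (E i) := by
  classical
  rw [sum_probOf_eq_sum_ncard_mul, probOf_eq_sum_suppFinset, Finset.mul_sum]
  refine le_trans (Finset.sum_le_sum fun s hs => ?_)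
    (Finset.sum_le_sum_of_subset_of_nonneg (Finset.filter_subset (· ∈ A) _) fun s _ _ =>
      mul_nonneg (Nat.cast_nonneg _) (π.nonneg ω s))
  exact mul_le_mul_of_nonneg_right (by exact_mod_cast h s (Finset.mem_filter.1 hs).2)
    (π.nonneg ω s)

lemma sum_probOf_le [Fintype N] {π : Experiment S} {ω : State} {E : N → Set (Signal S)} {M : ℕ}
    (h : ∀ s, {i | s ∈ E i}.ncard ≤ M) : ∑ i, probOf π ω (E i) ≤ M := by
  calc ∑ i, probOf π ω (E i)
      = ∑ s ∈ suppFinset π, ({i | s ∈ E i}.ncard : ℝ) * π.prob ω s :=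
        sum_probOf_eq_sum_ncard_mul π ω E
    _ ≤ ∑ s ∈ suppFinset π, (M : ℝ) * π.prob ω s := Finset.sum_le_sum fun s _ =>
        mul_le_mul_of_nonneg_right (by exact_mod_cast h s) (π.nonneg ω s)
    _ = M := by rw [← Finset.mul_sum, sum_suppFinset, mul_one]

lemma experimentValue_le_of_events [Finite N] (hpos : ∀ ω, 0 < prior ω) {k M : ℕ} (hk : 0 < k)
    {g : SimpleGraph N} {π : Experiment S} (E : N → Set (Signal S))
    (hobey : ∀ i, prior State.Y * probOf π State.Y (E i) ≤ prior State.X * probOf π State.X (E i))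
    (hlower : ∀ s ∈ successSet prior k g π, k ≤ {i | s ∈ E i}.ncard)
    (hupper : ∀ s, {i | s ∈ E i}.ncard ≤ M) :
    experimentValue prior k g π ≤ valueBound prior k M := by
  have := Fintype.ofFinite N
  have hchain : prior State.Y * probOf π State.Y (successSet prior k g π) * k ≤
      M * prior State.X :=
    calc prior State.Y * probOf π State.Y (successSet prior k g π) * k
        = prior State.Y * (k * probOf π State.Y (successSet prior k g π)) := by ring
      _ ≤ prior State.Y * ∑ i, probOf π State.Y (E i) :=
        mul_le_mul_of_nonneg_left (mul_probOf_le_sum_probOf hlower) (hpos _).le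
      _ ≤ prior State.X * ∑ i, probOf π State.X (E i) := by
        simpa only [Finset.mul_sum] using Finset.sum_le_sum fun i _ => hobey i
      _ ≤ prior State.X * M := mul_le_mul_of_nonneg_left (sum_probOf_le hupper) (hpos _).le
      _ = M * prior State.X := mul_comm _ _
  exact add_le_add (mul_le_of_le_one_right (hpos _).le (probOf_le_one ..))
    ((le_div_iff₀ (by exact_mod_cast hk)).2 hchain)

lemma networkValue_le_valueBound_card [Fintype N] (hpos : ∀ ω, 0 < prior ω) {k : ℕ} (hk : 0 < k)
    (g : SimpleGraph N) : networkValue S prior k g ≤ valueBound prior k (Fintype.card N) := by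
  refine Real.iSup_le (fun π => ?_) (valueBound_nonneg hpos _ _)
  refine experimentValue_le_of_events hpos hk (actX prior g π)
    (fun i => prior_mul_probOf_le_of_subset_actX hpos (fun s t h => (mem_actX_congr h).2) le_rfl)
    (fun s hs => (mem_successSet_iff.1 hs).2) fun s => ?_
  exact (Set.ncard_le_card _).trans_eq Nat.card_eq_fintype_card

/-- The event that receiver `i` takes action `x`, where the action of `r` is discounted whenever
all of `C` takes action `x`. -/
def actXDiscounted (prior : State → ℝ) (g : SimpleGraph N) (π : Experiment S) (C : Set N) (r : N)
    (i : N) : Set (Signal S) :=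
  {s | s ∈ actX prior g π i ∧ (i = r → ∃ j ∈ C, s ∉ actX prior g π j)}

lemma prior_mul_probOf_actXDiscounted_le (hpos : ∀ ω, 0 < prior ω) {g : SimpleGraph N}
    {C : Set N} {r : N} (hC : ∀ i ∈ C, nbhd g i ⊆ nbhd g r) (π : Experiment S) (i : N) :
    prior State.Y * probOf π State.Y (actXDiscounted prior g π C r i) ≤
      prior State.X * probOf π State.X (actXDiscounted prior g π C r i) := by
  refine prior_mul_probOf_le_of_subset_actX (g := g) (i := i) hpos (fun s t h hs => ?_)
    fun _ hs => hs.1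
  refine ⟨(mem_actX_congr h).2 hs.1, ?_⟩
  rintro rfl
  obtain ⟨j, hj, hsj⟩ := hs.2 rfl
  have hview : view g j t = view g j s :=
    view_eq_view_iff.2 fun l hl => view_eq_view_iff.1 h l (hC j hj hl)
  exact ⟨j, hj, mt (mem_actX_congr hview).1 hsj⟩

lemma le_ncard_actXDiscounted [Finite N] {k : ℕ} {g : SimpleGraph N} {π : Experiment S} {C : Set N}
    {r : N} (hr : r ∈ C) (hkC : k < C.ncard) {s : Signal S} (hs : s ∈ successSet prior k g π) :
    k ≤ {i | s ∈ actXDiscounted prior g π C r i}.ncard := by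
  by_cases hall : ∀ i ∈ C, s ∈ actX prior g π i
  · calc k ≤ (C \ {r}).ncard := by rw [Set.ncard_sdiff_singleton_of_mem hr]; omega
      _ ≤ {i | s ∈ actXDiscounted prior g π C r i}.ncard :=
        Set.ncard_le_ncard fun i hi => ⟨hall i hi.1, fun hir => absurd hir hi.2⟩
  · push Not at hall
    exact (mem_successSet_iff.1 hs).2.trans (Set.ncard_le_ncard fun i hi => ⟨hi, fun _ => hall⟩)

lemma ncard_actXDiscounted_le [Fintype N] {g : SimpleGraph N} {π : Experiment S} {C : Set N}
    {r : N} (s : Signal S) :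
    {i | s ∈ actXDiscounted prior g π C r i}.ncard ≤ Fintype.card N - 1 := by
  have hne : {i | s ∈ actXDiscounted prior g π C r i} ≠ Set.univ := by
    intro huniv
    have hmem : ∀ i, s ∈ actXDiscounted prior g π C r i := Set.eq_univ_iff_forall.1 huniv
    obtain ⟨j, _, hj⟩ := (hmem r).2 rfl
    exact hj (hmem j).1
  rw [← Nat.card_eq_fintype_card]
  exact Nat.le_sub_one_of_lt (Set.ncard_lt_card hne)

/-- When all of `C` takes action `x`, which `r` observes, the action of `r` is not needed for
success. Discounting it there, no more than `|N| - 1` receivers ever count. -/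
lemma networkValue_le_valueBound_card_sub_one [Fintype N] (hpos : ∀ ω, 0 < prior ω) {k : ℕ}
    (hk : 0 < k) {g : SimpleGraph N} {C : Set N} {r : N} (hr : r ∈ C) (hkC : k < C.ncard)
    (hC : ∀ i ∈ C, nbhd g i ⊆ nbhd g r) :
    networkValue S prior k g ≤ valueBound prior k (Fintype.card N - 1) :=
  Real.iSup_le (fun π => experimentValue_le_of_events hpos hk (actXDiscounted prior g π C r)
    (prior_mul_probOf_actXDiscounted_le hpos hC π) (fun _ => le_ncard_actXDiscounted hr hkC)
    ncard_actXDiscounted_le) (valueBound_nonneg hpos _ _)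

end ObedienceBound

section FiniteModels

variable {N T : Type*} [Fintype T] {S : N → Type*}

/-- The experiment that draws an element `t` of a finite type with probability `μ ω t` and sends
the signal `f t`. -/
noncomputable def Experiment.ofWeights (f : T → Signal S) (μ : State → T → ℝ)
    (hμ : ∀ ω t, 0 ≤ μ ω t) (hsum : ∀ ω, ∑ t, μ ω t = 1) : Experiment S where
  prob ω := ∑ t, Finsupp.single (f t) (μ ω t)
  nonneg ω s := by
    classical
    rw [Finsupp.finsetSum_apply]
    exact Finset.sum_nonneg fun t _ => Finsupp.single_nonneg.2 (hμ ω t) s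
  sum_eq_one ω := by
    classical
    rw [← hsum ω]
    change Finsupp.sum _ (fun _ r => r) = _
    rw [← Finsupp.sum_finsetSum_index (fun _ => rfl) fun _ _ _ => rfl]
    exact Finset.sum_congr rfl fun t _ => Finsupp.sum_single_index rfl

variable {f : T → Signal S} {μ : State → T → ℝ} {hμ : ∀ ω t, 0 ≤ μ ω t}
  {hsum : ∀ ω, ∑ t, μ ω t = 1}

open Classical in
lemma probOf_ofWeights (ω : State) (A : Set (Signal S)) :
    probOf (Experiment.ofWeights f μ hμ hsum) ω A = ∑ t with f t ∈ A, μ ω t := by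
  have hindicator : probOf (Experiment.ofWeights f μ hμ hsum) ω A =
      (∑ t, Finsupp.single (f t) (μ ω t)).sum fun s r => if s ∈ A then r else 0 :=
    Finset.sum_filter _ _
  rw [hindicator, ← Finsupp.sum_finsetSum_index (by simp) (by intros; split_ifs <;> simp),
    Finset.sum_filter]
  exact Finset.sum_congr rfl fun t _ => Finsupp.sum_single_index (by simp)

lemma mem_supp_ofWeights {ω : State} {t : T} (h : 0 < μ ω t) :
    f t ∈ supp (Experiment.ofWeights f μ hμ hsum) := by
  classical
  refine ⟨ω, ?_⟩
  change 0 < (∑ u, Finsupp.single (f u) (μ ω u)) (f t)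
  rw [Finsupp.finsetSum_apply]
  refine Finset.sum_pos' (fun u _ => Finsupp.single_nonneg.2 (hμ ω u) _) ⟨t, Finset.mem_univ t, ?_⟩
  rwa [Finsupp.single_eq_same]

open Classical in
/-- The total weight of the points at which receiver `i` observes the same messages as at `t`. -/
noncomputable def viewWeight {M : N → Type*} (g : SimpleGraph N) (m : T → Signal M) (ν : T → ℝ)
    (i : N) (t : T) : ℝ :=
  ∑ u with view g i (m u) = view g i (m t), ν u

lemma viewWeight_eq_of_equiv {M : N → Type*} {g : SimpleGraph N} {m : T → Signal M}
    {ν ν' : T → ℝ} {i : N} (e : T ≃ T) (hm : ∀ u, view g i (m (e u)) = view g i (m u))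
    (hν : ∀ u, ν' (e u) = ν u) (t : T) : viewWeight g m ν' i t = viewWeight g m ν i t := by
  classical
  simp only [viewWeight, Finset.sum_filter]
  rw [← Equiv.sum_comp e]
  exact Finset.sum_congr rfl fun u _ => if_congr (Eq.congr_left (hm u)) (hν u) rfl

lemma viewWeight_eq_zero {M : N → Type*} {g : SimpleGraph N} {m : T → Signal M} {ν : T → ℝ}
    {i : N} {t : T} (h : ∀ u, view g i (m u) = view g i (m t) → ν u = 0) :
    viewWeight g m ν i t = 0 := by
  classical
  exact Finset.sum_eq_zero fun u hu => h u (Finset.mem_filter.1 hu).2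

lemma viewWeight_sum_mul {κ : Type*} [Fintype κ] {M : N → Type*}
    (g : SimpleGraph N) (m : T → Signal M) (r : κ → ℝ) (ν : κ → T → ℝ) (i : N) (t : T) :
    viewWeight g m (fun u => ∑ a, r a * ν a u) i t = ∑ a, r a * viewWeight g m (ν a) i t := by
  simp only [viewWeight, Finset.mul_sum]
  exact Finset.sum_comm

lemma viewWeight_option_some {M : N → Type*} (g : SimpleGraph N)
    (m : T → Signal M) (ν : Option T → ℝ) (i : N) (t : T) :
    viewWeight (M := fun j => Option (M j)) g (fun u j => u.map (m · j)) ν i (some t) =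
      viewWeight g m (fun u => ν (some u)) i t := by
  classical
  have hnone : ¬ view (S := fun j => Option (M j)) g i (fun j => none) =
      view g i fun j => some (m t j) :=
    fun h => Option.some_ne_none _ (view_eq_view_iff.1 h i (Or.inr rfl)).symm
  have hsome : ∀ u, view (S := fun j => Option (M j)) g i (fun j => some (m u j)) =
      view g i (fun j => some (m t j)) ↔ view g i (m u) = view g i (m t) := fun u => by
    simp only [view_eq_view_iff, Option.some_inj]
  simp only [viewWeight, Finset.sum_filter, Fintype.sum_option, Option.map_none, Option.map_some,
    hnone, hsome, if_false, zero_add]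

lemma probOf_assocSet_ofWeights (g : SimpleGraph N) (ω : State) (i : N) (t : T) :
    probOf (Experiment.ofWeights f μ hμ hsum) ω
      (assocSet g (Experiment.ofWeights f μ hμ hsum) i (f t)) = viewWeight g f (μ ω) i t := by
  classical
  rw [probOf_ofWeights, viewWeight]
  refine Finset.sum_subset (fun u hu => ?_) fun u hu hu' => ?_
  · rw [Finset.mem_filter] at hu ⊢
    exact ⟨hu.1, view_eq_view_iff.2 hu.2.2⟩
  · by_contra hne
    have hpos : 0 < μ ω u := (hμ ω u).lt_of_ne' hne
    refine hu' (Finset.mem_filter.2 ⟨Finset.mem_univ u, mem_supp_ofWeights hpos, ?_⟩)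
    exact view_eq_view_iff.1 (Finset.mem_filter.1 hu).2

variable {prior : State → ℝ}

lemma le_experimentValue_ofWeights [Finite N] (hpos : ∀ ω, 0 < prior ω) {k : ℕ}
    {g : SimpleGraph N} {A : Finset T}
    (hA : ∀ t ∈ A, (∃ ω, 0 < μ ω t) → k ≤ {i | prior State.Y * viewWeight g f (μ State.Y) i t ≤
      prior State.X * viewWeight g f (μ State.X) i t}.ncard) :
    prior State.X * ∑ t ∈ A, μ State.X t + prior State.Y * ∑ t ∈ A, μ State.Y t ≤
      experimentValue prior k g (Experiment.ofWeights f μ hμ hsum) := by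
  classical
  set π := Experiment.ofWeights f μ hμ hsum with hπ
  have hsuccess : ∀ ω, ∑ t ∈ A, μ ω t ≤ probOf π ω (successSet prior k g π) := by
    intro ω
    rw [hπ, probOf_ofWeights, ← hπ]
    rw [← Finset.sum_filter_ne_zero]
    refine Finset.sum_le_sum_of_subset_of_nonneg (fun t ht => ?_) fun t _ _ => hμ ω t
    obtain ⟨ht, hne⟩ := Finset.mem_filter.1 ht
    have hpos' : 0 < μ ω t := (hμ ω t).lt_of_ne' hne
    have hsupp : f t ∈ supp π := mem_supp_ofWeights hpos'
    refine Finset.mem_filter.2 ⟨Finset.mem_univ t, mem_successSet_iff.2 ⟨hsupp, ?_⟩⟩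
    refine (hA t ht ⟨ω, hpos'⟩).trans (Set.ncard_le_ncard fun i hi => ?_)
    rw [Set.mem_ofPred_eq, mem_actX_iff hpos hsupp, hπ, probOf_assocSet_ofWeights,
      probOf_assocSet_ofWeights]
    exact hi
  exact add_le_add (mul_le_mul_of_nonneg_left (hsuccess _) (hpos _).le)
    (mul_le_mul_of_nonneg_left (hsuccess _) (hpos _).le)

lemma exists_signal_encoding {T : Type*} [Finite T] {M : N → Type*} (S : N → Type*)
    [∀ i, Infinite (S i)] (m : T → Signal M) :
    ∃ f : T → Signal S, ∀ t u i, f t i = f u i ↔ m t i = m u i := by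
  have e : ∀ i, Set.range (fun t => m t i) ↪ S i := fun i =>
    (nonempty_embedding_nat _).some.trans (Infinite.natEmbedding (S i))
  refine ⟨fun t i => e i ⟨m t i, Set.mem_range_self t⟩, fun t u i => ?_⟩
  exact ((e i).apply_eq_iff_eq _ _).trans Subtype.mk_eq_mk

lemma le_networkValue_of_weights [Finite N] [∀ i, Infinite (S i)] (hpos : ∀ ω, 0 < prior ω)
    {M : N → Type*} (m : T → Signal M) {k : ℕ} {g : SimpleGraph N} (hμ : ∀ ω t, 0 ≤ μ ω t)
    (hsum : ∀ ω, ∑ t, μ ω t = 1) {A : Finset T}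
    (hA : ∀ t ∈ A, (∃ ω, 0 < μ ω t) → k ≤ {i | prior State.Y * viewWeight g m (μ State.Y) i t ≤
      prior State.X * viewWeight g m (μ State.X) i t}.ncard) :
    prior State.X * ∑ t ∈ A, μ State.X t + prior State.Y * ∑ t ∈ A, μ State.Y t ≤
      networkValue S prior k g := by
  classical
  obtain ⟨f, hf⟩ := exists_signal_encoding S m
  have hview : ∀ ν : T → ℝ, viewWeight g f ν = viewWeight g m ν := fun ν => by
    funext i t
    simp only [viewWeight, view_eq_view_iff, hf]
  refine (le_experimentValue_ofWeights (f := f) (hμ := hμ) (hsum := hsum) hpos ?_).trans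
    (le_ciSup (bddAbove_range_experimentValue hpos k g) _)
  simpa only [hview] using hA

lemma view_bot_eq_view_bot_iff {M : N → Type*} {i : N} {s t : Signal M} :
    view ⊥ i s = view ⊥ i t ↔ s i = t i := by
  rw [view_eq_view_iff]
  simp only [nbhd, SimpleGraph.bot_adj, false_or, Set.mem_ofPred_eq, forall_eq]

/-- On the empty network, every receiver can be sent what it observes on `g`. -/
lemma networkValue_le_privateValue [Finite N] [∀ i, Infinite (S i)] (hpos : ∀ ω, 0 < prior ω)
    (k : ℕ) (g : SimpleGraph N) : networkValue S prior k g ≤ privateValue S prior k := by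
  classical
  refine Real.iSup_le (fun π => ?_) (Real.iSup_nonneg fun π => experimentValue_nonneg hpos k ⊥ π)
  let m : suppFinset π → (i : N) → (j : nbhd g i) → S j := fun t i => view g i t
  have hweight : ∀ ω i (t : suppFinset π), viewWeight ⊥ m (fun t => π.prob ω t) i t =
      probOf π ω (assocSet g π i t) := by
    intro ω i t
    rw [probOf_eq_sum_suppFinset, viewWeight, Finset.sum_filter, Finset.sum_filter,
      ← Finset.sum_coe_sort (suppFinset π)]
    refine Finset.sum_congr rfl fun u _ => if_congr ?_ rfl rfl
    rw [view_bot_eq_view_bot_iff, view_eq_view_iff]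
    exact ⟨fun h => ⟨mem_suppFinset.1 u.2, h⟩, fun h => h.2⟩
  have hvalue : ∀ ω, probOf π ω (successSet prior k g π) =
      ∑ t : suppFinset π with ↑t ∈ successSet prior k g π, π.prob ω t := by
    intro ω
    rw [probOf_eq_sum_suppFinset, Finset.sum_filter, Finset.sum_filter,
      ← Finset.sum_coe_sort (suppFinset π)]
  rw [experimentValue, hvalue, hvalue]
  refine le_networkValue_of_weights hpos m (fun ω t => π.nonneg ω t)
    (fun ω => (Finset.sum_coe_sort _ _).trans (sum_suppFinset π ω)) fun t ht _ => ?_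
  have hsuccess := mem_successSet_iff.1 (Finset.mem_filter.1 ht).2
  simpa only [hweight, mem_actX_iff hpos hsuccess.1] using hsuccess.2

end FiniteModels

section KeySharing

open Classical in
/-- A random set of at least `k` receivers that contains every receiver with probability
`k / |N|`. -/
structure BalancedFamily (N : Type*) [Fintype N] (k : ℕ) (ι : Type*) [Fintype ι] where
  weight : ι → ℝ
  set : ι → Finset N
  weight_nonneg : ∀ a, 0 ≤ weight a
  sum_weight : ∑ a, weight a = 1
  le_card : ∀ a, k ≤ (set a).card
  marginal : ∀ i, ∑ a with i ∈ set a, weight a = (k : ℝ) / Fintype.card N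

variable {N ι : Type*}

/-- For every coalition `a`, the parity of the shares that are held by the receivers in `K a`. -/
def parity (K : ι → Finset N) (b : N → ι → ZMod 2) (a : ι) : ZMod 2 :=
  ∑ j ∈ K a, b j a

lemma parity_add (K : ι → Finset N) (b b' : N → ι → ZMod 2) :
    parity K (b + b') = parity K b + parity K b' :=
  funext fun _ => Finset.sum_add_distrib

lemma parity_single [DecidableEq ι] [DecidableEq N] {K : ι → Finset N} {a : ι} {j : N}
    (hj : j ∈ K a) : parity K (Pi.single j (Pi.single a 1)) = Pi.single a 1 := by
  funext a'
  have hterm : ∀ i, (Pi.single j (Pi.single a 1) : N → ι → ZMod 2) i a' =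
      if i = j then (Pi.single a 1 : ι → ZMod 2) a' else 0 := fun i => by
    rw [Pi.single_apply]
    split_ifs <;> rfl
  rw [parity, Finset.sum_congr rfl fun i _ => hterm i, Finset.sum_ite_eq', ite_eq_left_iff]
  intro hja
  rw [Pi.single_eq_of_ne (by rintro rfl; exact hja hj)]

variable [Fintype N] [Fintype ι] {k : ℕ} {g : SimpleGraph N} {K : ι → Finset N} {prior : State → ℝ}

lemma BalancedFamily.exists_weight_ne_zero (B : BalancedFamily N k ι) : ∃ a, B.weight a ≠ 0 := by
  obtain ⟨a, -, ha⟩ := Finset.exists_ne_zero_of_sum_ne_zero (B.sum_weight.trans_ne one_ne_zero)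
  exact ⟨a, ha⟩

section Decidable

variable [DecidableEq N] [DecidableEq ι]

/-- The uniform distribution of shares conditional on the parities `z`. -/
noncomputable def keyDensity (K : ι → Finset N) (z : ι → ZMod 2) (b : N → ι → ZMod 2) : ℝ :=
  if parity K b = z then (Finset.card {b' | parity K b' = 0} : ℝ)⁻¹ else 0

lemma keyDensity_nonneg (K : ι → Finset N) (z : ι → ZMod 2) (b : N → ι → ZMod 2) :
    0 ≤ keyDensity K z b := by
  rw [keyDensity]
  positivity

lemma card_parity_eq_zero_pos (K : ι → Finset N) : 0 < Finset.card {b | parity K b = 0} :=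
  Finset.card_pos.2 ⟨0, Finset.mem_filter.2
    ⟨Finset.mem_univ _, funext fun _ => Finset.sum_const_zero⟩⟩

lemma keyDensity_ne_zero_iff {K : ι → Finset N} {z : ι → ZMod 2} {b : N → ι → ZMod 2} :
    keyDensity K z b ≠ 0 ↔ parity K b = z := by
  rw [keyDensity, ne_eq, ite_eq_right_iff, Classical.not_imp, and_iff_left]
  exact inv_ne_zero (Nat.cast_ne_zero.2 (card_parity_eq_zero_pos K).ne')

lemma sum_keyDensity_zero (K : ι → Finset N) : ∑ b, keyDensity K 0 b = 1 := by
  simp only [keyDensity]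
  rw [← Finset.sum_filter, Finset.sum_const, nsmul_eq_mul]
  exact mul_inv_cancel₀ (Nat.cast_ne_zero.2 (card_parity_eq_zero_pos K).ne')

lemma keyDensity_single_add_single {K : ι → Finset N} {a : ι} {j : N} (hj : j ∈ K a)
    (b : N → ι → ZMod 2) :
    keyDensity K (Pi.single a 1) (b + Pi.single j (Pi.single a 1)) = keyDensity K 0 b := by
  simp only [keyDensity, parity_add, parity_single hj, add_eq_right]

lemma sum_keyDensity_single {K : ι → Finset N} {a : ι} (hK : (K a).Nonempty) :
    ∑ b, keyDensity K (Pi.single a 1) b = 1 := by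
  obtain ⟨j, hj⟩ := hK
  rw [← sum_keyDensity_zero K, ← Equiv.sum_comp (Equiv.addRight (Pi.single j (Pi.single a 1)))]
  exact Finset.sum_congr rfl fun b _ => keyDensity_single_add_single hj b

/-- Flipping the share `j`, which receiver `i` does not see, exchanges the two events. -/
lemma viewWeight_keyDensity_single_of_notMem {a : ι} {i j : N} (hj : j ∈ K a) (hij : j ∉ nbhd g i)
    (b : N → ι → ZMod 2) :
    viewWeight g id (keyDensity K (Pi.single a 1)) i b = viewWeight g id (keyDensity K 0) i b := by
  refine viewWeight_eq_of_equiv (Equiv.addRight (Pi.single j (Pi.single a 1))) (fun b' => ?_)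
    (keyDensity_single_add_single hj) b
  refine view_eq_view_iff.2 fun l hl => ?_
  change (b' + Pi.single j (Pi.single a 1) : N → ι → ZMod 2) l = b' l
  rw [Pi.add_apply, Pi.single_eq_of_ne (ne_of_mem_of_not_mem hl hij), add_zero]

lemma viewWeight_keyDensity_single_of_subset {a : ι} {i : N} (hK : ↑(K a) ⊆ nbhd g i)
    {b : N → ι → ZMod 2} (hb : parity K b a = 0) :
    viewWeight g id (keyDensity K (Pi.single a 1)) i b = 0 := by
  refine viewWeight_eq_zero fun b' hb' => ?_
  by_contra hne
  have hsame : parity K b' a = parity K b a := Finset.sum_congr rfl fun j hj => by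
    rw [show b' j = b j from view_eq_view_iff.1 hb' j (hK hj)]
  rw [keyDensity_ne_zero_iff.1 hne, hb, Pi.single_eq_same] at hsame
  exact one_ne_zero hsame

/-- The law of the shares in the key-sharing experiment. All parities vanish in state `X`. In state
`Y`, the value `none` reveals the state with probability `1 - c`. Otherwise a coalition `a` is drawn
from `p`, and exactly the parity of `a` does not vanish, which those outside `a` will notice. -/
noncomputable def keyWeight (K : ι → Finset N) (c : ℝ) (p : ι → ℝ) :
    State → Option (N → ι → ZMod 2) → ℝ
  | State.X, none => 0
  | State.X, some b => keyDensity K 0 b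
  | State.Y, none => 1 - c
  | State.Y, some b => ∑ a, c * p a * keyDensity K (Pi.single a 1) b

lemma keyWeight_nonneg (K : ι → Finset N) {c : ℝ} (hc : 0 ≤ c) (hc' : c ≤ 1) {p : ι → ℝ}
    (hp : ∀ a, 0 ≤ p a) : ∀ ω t, 0 ≤ keyWeight K c p ω t
  | State.X, none => le_rfl
  | State.X, some b => keyDensity_nonneg K 0 b
  | State.Y, none => sub_nonneg.2 hc'
  | State.Y, some b => Finset.sum_nonneg fun a _ =>
      mul_nonneg (mul_nonneg hc (hp a)) (keyDensity_nonneg K _ b)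

lemma sum_keyWeight_X (K : ι → Finset N) (c : ℝ) (p : ι → ℝ) :
    ∑ b, keyWeight K c p State.X (some b) = 1 :=
  sum_keyDensity_zero K

lemma sum_keyWeight_Y {K : ι → Finset N} (hK : ∀ a, (K a).Nonempty) (c : ℝ) {p : ι → ℝ}
    (hp : ∑ a, p a = 1) : ∑ b, keyWeight K c p State.Y (some b) = c := by
  calc ∑ b, keyWeight K c p State.Y (some b)
      = ∑ a, c * p a * ∑ b, keyDensity K (Pi.single a 1) b := by
        simp only [keyWeight, Finset.mul_sum]
        exact Finset.sum_comm
    _ = c := by simp only [sum_keyDensity_single (hK _), mul_one, ← Finset.mul_sum, hp]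

/-- A receiver that sees no violated parity cannot tell the coalitions to which it belongs from
state `X` and rules out all others. -/
lemma viewWeight_keyWeight_Y (B : BalancedFamily N k ι)
    (hK : ∀ a i, i ∈ B.set a ↔ ¬ ↑(K a) ⊆ nbhd g i) (c : ℝ) {i : N} {b : N → ι → ZMod 2}
    (hb : ∀ a, i ∉ B.set a → parity K b a = 0) :
    viewWeight g id (fun b => keyWeight K c B.weight State.Y (some b)) i b =
      c * (k / Fintype.card N) * viewWeight g id (keyDensity K 0) i b := by
  simp only [keyWeight]
  rw [viewWeight_sum_mul, ← B.marginal i, Finset.sum_filter, Finset.mul_sum, Finset.sum_mul]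
  refine Finset.sum_congr rfl fun a _ => ?_
  split_ifs with hia
  · obtain ⟨j, hj, hij⟩ := Set.not_subset.1 ((hK a i).1 hia)
    rw [viewWeight_keyDensity_single_of_notMem hj hij]
  · rw [viewWeight_keyDensity_single_of_subset (not_not.1 (mt (hK a i).2 hia)) (hb a hia)]
    ring

lemma prior_mul_viewWeight_keyWeight_eq (B : BalancedFamily N k ι) (hk : k ≠ 0)
    (hK : ∀ a i, i ∈ B.set a ↔ ¬ ↑(K a) ⊆ nbhd g i) {c : ℝ}
    (hc : prior State.Y * c = Fintype.card N * prior State.X / k) {i : N} {b : N → ι → ZMod 2}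
    (hb : ∀ a, i ∉ B.set a → parity K b a = 0) :
    prior State.Y * viewWeight g id (fun b => keyWeight K c B.weight State.Y (some b)) i b =
      prior State.X * viewWeight g id (fun b => keyWeight K c B.weight State.X (some b)) i b := by
  have : Nonempty N := ⟨i⟩
  have hN : (Fintype.card N : ℝ) ≠ 0 := Nat.cast_ne_zero.2 Fintype.card_ne_zero
  have hk' : (k : ℝ) ≠ 0 := Nat.cast_ne_zero.2 hk
  have hX : prior State.Y * (c * (k / Fintype.card N)) = prior State.X := by
    rw [← mul_assoc, hc]
    field_simp
  rw [viewWeight_keyWeight_Y B hK c hb, ← mul_assoc, hX]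
  rfl

lemma le_ncard_of_keyWeight_ne_zero (B : BalancedFamily N k ι) {c : ℝ} {ω : State}
    {b : N → ι → ZMod 2} (h : keyWeight K c B.weight ω (some b) ≠ 0) :
    k ≤ {i | ∀ a, i ∉ B.set a → parity K b a = 0}.ncard := by
  obtain ⟨a, ha⟩ : ∃ a, ∀ a' ≠ a, parity K b a' = 0 := by
    cases ω
    · obtain ⟨a, -⟩ := B.exists_weight_ne_zero
      exact ⟨a, fun a' _ => by rw [keyDensity_ne_zero_iff.1 h, Pi.zero_apply]⟩
    · obtain ⟨a, -, ha⟩ := Finset.exists_ne_zero_of_sum_ne_zero h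
      refine ⟨a, fun a' ha' => ?_⟩
      rw [keyDensity_ne_zero_iff.1 (right_ne_zero_of_mul ha), Pi.single_eq_of_ne ha']
  refine (B.le_card a).trans ?_
  rw [← Set.ncard_coe_finset]
  exact Set.ncard_le_ncard fun i hi a' ha' => ha a' fun h => ha' (h ▸ hi)

end Decidable

/-- Coalition `a` consists of those who cannot see the whole key `K a`. In state `Y` the coalitions
are persuaded as often as state `X` permits. -/
theorem valueBound_le_networkValue_of_keys {S : N → Type*} [∀ i, Infinite (S i)]
    (hpos : ∀ ω, 0 < prior ω) (hk : 0 < k) (B : BalancedFamily N k ι)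
    (hK : ∀ a i, i ∈ B.set a ↔ ¬ ↑(K a) ⊆ nbhd g i)
    (hprior : Fintype.card N * prior State.X / k ≤ prior State.Y) :
    valueBound prior k (Fintype.card N) ≤ networkValue S prior k g := by
  classical
  set c := Fintype.card N * prior State.X / k / prior State.Y
  have hYc : prior State.Y * c = Fintype.card N * prior State.X / k :=
    mul_div_cancel₀ _ (hpos _).ne'
  have hc0 : 0 ≤ c := by
    have hX := hpos State.X
    have hY := hpos State.Y
    positivity
  have hc1 : c ≤ 1 := div_le_one_of_le₀ hprior (hpos _).le
  have hnonempty : ∀ a, (K a).Nonempty := fun a => by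
    obtain ⟨i, hi⟩ := Finset.card_pos.1 (hk.trans_le (B.le_card a))
    obtain ⟨j, hj, -⟩ := Set.not_subset.1 ((hK a i).1 hi)
    exact ⟨j, hj⟩
  have hsumX := sum_keyWeight_X K c B.weight
  have hsumY := sum_keyWeight_Y hnonempty c B.sum_weight
  have hsum : ∀ ω, ∑ t, keyWeight K c B.weight ω t = 1 := by
    rintro (_ | _) <;> rw [Fintype.sum_option]
    · rw [hsumX, keyWeight, zero_add]
    · rw [hsumY, keyWeight, sub_add_cancel]
  have hvalue := le_networkValue_of_weights (S := S) (M := fun _ => Option (ι → ZMod 2)) (k := k)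
    (g := g) (A := Finset.univ.map Function.Embedding.some) hpos (fun t j => t.map (· j))
    (keyWeight_nonneg K hc0 hc1 B.weight_nonneg) hsum fun t ht ⟨ω, hω⟩ => ?_
  · simpa only [Finset.sum_map, Function.Embedding.some_apply, hsumX, hsumY, hYc, mul_one,
      valueBound] using hvalue
  · obtain ⟨b, -, rfl⟩ := Finset.mem_map.1 ht
    refine (le_ncard_of_keyWeight_ne_zero B hω.ne').trans (Set.ncard_le_ncard fun i hi => ?_)
    have hview := fun ν => viewWeight_option_some (M := fun _ => ι → ZMod 2) g id ν i b
    exact ((hview _).symm ▸ (hview _).symm ▸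
      (prior_mul_viewWeight_keyWeight_eq B hk.ne' hK hYc hi).le :)

end KeySharing

section BalancedFamilies

variable {k : ℕ}

/-- Transport of a balanced family along a bijection of the receivers. -/
noncomputable def BalancedFamily.map {N N' ι : Type*} [Fintype N] [Fintype N'] [Fintype ι]
    (e : N ≃ N') (B : BalancedFamily N k ι) : BalancedFamily N' k ι where
  weight := B.weight
  set a := (B.set a).map e.toEmbedding
  weight_nonneg := B.weight_nonneg
  sum_weight := B.sum_weight
  le_card a := (B.le_card a).trans_eq (Finset.card_map _).symm
  marginal i := by
    classical
    rw [← Fintype.card_congr e, ← B.marginal (e.symm i)]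
    exact Finset.sum_congr (Finset.filter_congr fun a _ => Finset.mem_map_equiv) fun _ _ => rfl

variable {G Q : Type*} [AddGroup G] [Fintype G] [DecidableEq G] [Fintype Q]

/-- The translate by `t` of the reflection of `A`, which every point belongs to for exactly `|A|`
values of `t`. -/
def reflectedTranslate (A : Finset G) (t : G) : Finset G := {s | t - s ∈ A}

lemma card_reflectedTranslate (A : Finset G) (t : G) : (reflectedTranslate A t).card = A.card :=
  Finset.card_equiv (Equiv.subLeft t) fun s => by simp [reflectedTranslate]

lemma card_filter_mem_reflectedTranslate (A : Finset G) (s : G) :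
    Finset.card {t | s ∈ reflectedTranslate A t} = A.card :=
  Finset.card_equiv (Equiv.subRight s) fun t => by simp [reflectedTranslate]

lemma sum_filter_mem_reflectedTranslate (A : Finset G) (s : G) (x : ℝ) :
    ∑ t with s ∈ reflectedTranslate A t, x = A.card * x := by
  rw [Finset.sum_const, card_filter_mem_reflectedTranslate, nsmul_eq_mul]

/-- With probability `k / (|G| + |Q|)`, the block `Q` joins a random reflected translate of a set
`A` with `k - |Q|` elements; otherwise one of a set `A'` with `k` elements is drawn. -/
noncomputable def BalancedFamily.block (A A' : Finset G) (hA : A.card + Fintype.card Q = k)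
    (hA' : A'.card = k) : BalancedFamily (G ⊕ Q) k (G ⊕ G) where
  weight := Sum.elim (fun _ => (k : ℝ) / (Fintype.card G + Fintype.card Q) / Fintype.card G)
    fun _ => (1 - (k : ℝ) / (Fintype.card G + Fintype.card Q)) / Fintype.card G
  set := Sum.elim (fun t => (reflectedTranslate A t).disjSum Finset.univ)
    fun t => (reflectedTranslate A' t).disjSum ∅
  weight_nonneg := by
    rintro (_ | _)
    · dsimp only [Sum.elim_inl]
      positivity
    · refine div_nonneg (sub_nonneg.2 (div_le_one_of_le₀ ?_ (by positivity))) (by positivity)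
      exact_mod_cast (hA' ▸ A'.card_le_univ).trans (Nat.le_add_right _ _)
  sum_weight := by
    have hG : (Fintype.card G : ℝ) ≠ 0 := Nat.cast_ne_zero.2 Fintype.card_ne_zero
    simp only [Fintype.sum_sum_type, Sum.elim_inl, Sum.elim_inr, Finset.sum_const, Finset.card_univ,
      nsmul_eq_mul, mul_div_cancel₀ _ hG, add_sub_cancel]
  le_card := by
    rintro (t | t)
    · simp only [Sum.elim_inl, Finset.card_disjSum, card_reflectedTranslate, Finset.card_univ, hA,
        le_refl]
    · simp only [Sum.elim_inr, Finset.card_disjSum, card_reflectedTranslate, Finset.card_empty, hA',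
        add_zero, le_refl]
  marginal i := by
    have hG : (Fintype.card G : ℝ) ≠ 0 := Nat.cast_ne_zero.2 Fintype.card_ne_zero
    have hGQ : (Fintype.card G : ℝ) + Fintype.card Q ≠ 0 := by positivity
    have hAk : (A.card : ℝ) = k - Fintype.card Q := by rw [← hA, Nat.cast_add, add_sub_cancel_right]
    rw [Finset.sum_filter, Fintype.sum_sum_type, Fintype.card_sum, Nat.cast_add]
    rcases i with s | q
    · simp only [Sum.elim_inl, Sum.elim_inr, Finset.inl_mem_disjSum, ← Finset.sum_filter,
        sum_filter_mem_reflectedTranslate, hAk, hA']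
      field_simp
      ring
    · simp only [Sum.elim_inl, Sum.elim_inr, Finset.inr_mem_disjSum, Finset.mem_univ, if_true,
        Finset.notMem_empty, if_false, Finset.sum_const_zero, Finset.sum_const, Finset.card_univ,
        nsmul_eq_mul, mul_div_cancel₀ _ hG, add_zero]

lemma exists_balancedFamily_block {N : Type*} [Fintype N] (hk : 0 < k) {Q : Finset N}
    (hQ : Q.card ≤ k) (hkQ : k + Q.card ≤ Fintype.card N) :
    ∃ (ι : Type) (_ : Fintype ι) (B : BalancedFamily N k ι),
      ∀ a, ∀ i ∈ Q, ∀ j ∈ Q, i ∈ B.set a → j ∈ B.set a := by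
  classical
  obtain ⟨m, hm⟩ : ∃ m, Fintype.card {i // i ∉ Q} = m + 1 := Nat.exists_eq_succ_of_ne_zero <| by
    rw [Fintype.card_subtype_compl, Fintype.card_coe]
    lia
  have hmQ : m + 1 + Q.card = Fintype.card N := by
    rw [← hm, Fintype.card_subtype_compl, Fintype.card_coe]
    lia
  let e : Fin (m + 1) ⊕ Q ≃ N :=
    (Equiv.sumComm _ _).trans <|
      (Equiv.sumCongr (Equiv.refl _) (Fintype.equivFinOfCardEq hm).symm).trans <|
        Equiv.sumCompl (· ∈ Q)
  have exists_card : ∀ j ≤ m + 1, ∃ A : Finset (Fin (m + 1)), A.card = j := fun j hj => by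
    obtain ⟨A, -, hA⟩ := Finset.exists_subset_card_eq
      (hj.trans_eq (Finset.card_fin (m + 1)).symm)
    exact ⟨A, hA⟩
  obtain ⟨A, hA⟩ := exists_card (k - Q.card) (by lia)
  obtain ⟨A', hA'⟩ := exists_card k (by lia)
  let B : BalancedFamily (Fin (m + 1) ⊕ Q) k (Fin (m + 1) ⊕ Fin (m + 1)) :=
    BalancedFamily.block A A' (by rw [Fintype.card_coe]; lia) hA'
  have he : ∀ i (hi : i ∈ Q), e.symm i = Sum.inr ⟨i, hi⟩ := fun i hi =>
    (Equiv.symm_apply_eq e).2 rfl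
  refine ⟨_, inferInstance, B.map e, fun a i hi j hj => ?_⟩
  simp only [BalancedFamily.map, Finset.mem_map_equiv, he i hi, he j hj]
  rcases a with t | t <;> simp [B, BalancedFamily.block]

end BalancedFamilies

section Partners

variable {V : Type*} {g : SimpleGraph V} {w : V → V} {k : ℕ}

/-- A choice of a partner for every receiver, among those to which it is not linked. Every partner
is the partner of its own partner, so that the pairs of partners form disjoint stars. -/
structure IsPartnerMap (g : SimpleGraph V) (w : V → V) : Prop where
  compl_adj : ∀ v, gᶜ.Adj v (w v)
  apply_apply_apply : ∀ v, w (w (w v)) = w v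

/-- The network in which exactly the links between partners are missing. -/
def partnerNetwork (w : V → V) : SimpleGraph V where
  Adj u v := u ≠ v ∧ w u ≠ v ∧ w v ≠ u
  symm := ⟨fun _ _ h => ⟨h.1.symm, h.2.2, h.2.1⟩⟩
  loopless := ⟨fun _ h => h.1 rfl⟩

lemma IsPartnerMap.le_partnerNetwork (hw : IsPartnerMap g w) : g ≤ partnerNetwork w :=
  fun u v huv => ⟨huv.ne, fun h => (hw.compl_adj u).2 (h ▸ huv),
    fun h => (hw.compl_adj v).2 (h ▸ huv.symm)⟩

lemma IsPartnerMap.mem_nbhd_partnerNetwork_iff (hw : IsPartnerMap g w) {u v : V} :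
    w v ∈ nbhd (partnerNetwork w) u ↔ w v ≠ w u := by
  constructor
  · rintro (h | h) heq
    · exact h.2.1 heq.symm
    · exact (hw.compl_adj u).ne (heq ▸ h).symm
  · intro hne
    by_cases hvu : w v = u
    · exact Or.inr hvu
    · refine Or.inl ⟨Ne.symm hvu, hne.symm, fun h => hne ?_⟩
      rw [← h, hw.apply_apply_apply]

/-- The receivers can be assigned partners such that some balanced family never separates receivers
with the same partner. -/
def HasKeySharing [Fintype V] (g : SimpleGraph V) (k : ℕ) : Prop :=
  ∃ w, IsPartnerMap g w ∧ ∃ (ι : Type) (_ : Fintype ι) (B : BalancedFamily V k ι),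
    ∀ a i j, w i = w j → i ∈ B.set a → j ∈ B.set a

/-- The key of a coalition is held by the partners of its members. -/
theorem HasKeySharing.exists_extension [Fintype V] {S : V → Type*} [∀ i, Infinite (S i)]
    {prior : State → ℝ} (hg : HasKeySharing g k) (hpos : ∀ ω, 0 < prior ω) (hk : 0 < k)
    (hprior : Fintype.card V * prior State.X / k ≤ prior State.Y) :
    ∃ g', g ≤ g' ∧ valueBound prior k (Fintype.card V) ≤ networkValue S prior k g' := by
  classical
  obtain ⟨w, hw, ι, _, B, hB⟩ := hg
  refine ⟨partnerNetwork w, hw.le_partnerNetwork,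
    valueBound_le_networkValue_of_keys (K := fun a => (B.set a).image w) hpos hk B
      (fun a i => ?_) hprior⟩
  rw [Finset.coe_image, Set.image_subset_iff, Set.not_subset]
  simp only [Set.mem_preimage, hw.mem_nbhd_partnerNetwork_iff, not_not]
  exact ⟨fun hi => ⟨i, hi, rfl⟩, fun ⟨j, hj, hji⟩ => hB a j i hji hj⟩

end Partners

section Matchings

variable {V : Type*} {g H : SimpleGraph V} {k : ℕ}

lemma exists_isPartnerMap_of_isMatching [Finite V] {M : gᶜ.Subgraph} (hM : M.IsMatching)
    (hcard : M.vertsᶜ.ncard ≤ 1) (hnbr : ∀ v, ∃ u, gᶜ.Adj v u) :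
    ∃ w, IsPartnerMap g w ∧ ∃ Q : Finset V, Q.card ≤ 2 ∧
      ∀ i j, w i = w j → i = j ∨ i ∈ Q ∧ j ∈ Q := by
  classical
  have := Fintype.ofFinite V
  have hpartner : ∀ v, ∃ u, gᶜ.Adj v u ∧ (v ∈ M.verts → M.Adj v u) := fun v => by
    by_cases hv : v ∈ M.verts
    · obtain ⟨u, hu, -⟩ := hM hv
      exact ⟨u, hu.adj_sub, fun _ => hu⟩
    · obtain ⟨u, hu⟩ := hnbr v
      exact ⟨u, hu, fun h => absurd h hv⟩
  choose w hw hwM using hpartner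
  have hunique : ∀ {u v}, u ∉ M.verts → v ∉ M.verts → u = v := fun hu hv =>
    (Set.ncard_le_one_iff (Set.toFinite _)).1 hcard hu hv
  have hmem : ∀ v, w v ∈ M.verts := fun v => by
    by_contra h
    by_cases hv : v ∈ M.verts
    · exact h (hwM v hv).snd_mem
    · exact (hw v).ne (hunique hv h)
  have hinvol : ∀ v ∈ M.verts, w (w v) = v := fun v hv =>
    (hM (hmem v)).unique (hwM _ (hmem v)) (hwM v hv).symm
  refine ⟨w, ⟨hw, fun v => hinvol _ (hmem v)⟩,
    M.vertsᶜ.toFinset ∪ M.vertsᶜ.toFinset.image (w ∘ w), ?_, fun i j hij => ?_⟩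
  · rw [Set.ncard_eq_toFinset_card'] at hcard
    have himage := Finset.card_image_le (s := M.vertsᶜ.toFinset) (f := w ∘ w)
    exact (Finset.card_union_le _ _).trans (by lia)
  · simp only [Finset.mem_union, Set.mem_toFinset, Set.mem_compl_iff, Finset.mem_image]
    by_cases hi : i ∈ M.verts <;> by_cases hj : j ∈ M.verts
    · exact Or.inl (by rw [← hinvol i hi, hij, hinvol j hj])
    · exact Or.inr ⟨Or.inr ⟨j, hj, by rw [Function.comp, ← hij, hinvol i hi]⟩, Or.inl hj⟩
    · exact Or.inr ⟨Or.inl hi, Or.inr ⟨i, hi, by rw [Function.comp, hij, hinvol j hj]⟩⟩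
    · exact Or.inl (hunique hi hj)

theorem hasKeySharing_of_isMatching [Fintype V] {M : gᶜ.Subgraph} (hM : M.IsMatching)
    (hcard : M.vertsᶜ.ncard ≤ 1) (hnbr : ∀ v, ∃ u, gᶜ.Adj v u) (hk : 2 ≤ k)
    (hkV : k + 2 ≤ Fintype.card V) : HasKeySharing g k := by
  obtain ⟨w, hw, Q, hQ, hfiber⟩ := exists_isPartnerMap_of_isMatching hM hcard hnbr
  obtain ⟨ι, _, B, hB⟩ := exists_balancedFamily_block (by lia) (hQ.trans hk) (by lia)
  refine ⟨w, hw, ι, inferInstance, B, fun a i j hij hi => ?_⟩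
  obtain rfl | ⟨hiQ, hjQ⟩ := hfiber i j hij
  · exact hi
  · exact hB a i hiQ j hjQ hi

lemma exists_nearPerfect_isMatching [Finite V] {C : Set V}
    (hC : ∀ u ∈ C, ∀ v ∉ C, H.Adj u v) {M : H.Subgraph} (hM : M.IsMatching) (hMC : M.verts ⊆ C)
    (hle : Cᶜ.ncard ≤ (C \ M.verts).ncard) (hge : (C \ M.verts).ncard ≤ Cᶜ.ncard + 1) :
    ∃ M' : H.Subgraph, M'.IsMatching ∧ M'.vertsᶜ.ncard ≤ 1 := by
  obtain ⟨s, hs, hcard⟩ := Set.exists_subset_card_eq hle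
  have hsC : Disjoint s Cᶜ := Set.disjoint_compl_right_iff_subset.2 (hs.trans Set.sdiff_subset)
  obtain ⟨e⟩ : Nonempty (s ≃ (Cᶜ : Set V)) := Finite.card_eq.1 hcard
  obtain ⟨M', hverts, hM'⟩ := SimpleGraph.Subgraph.IsMatching.exists_of_disjoint_sets_of_equiv hsC e
    fun v => hC v (hs v.2).1 _ (e v).2
  refine ⟨M ⊔ M', hM.sup hM' ?_, ?_⟩
  · rw [hM.support_eq_verts, hM'.support_eq_verts, hverts, Set.disjoint_union_right]
    exact ⟨Set.disjoint_of_subset_right hs Set.disjoint_sdiff_right,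
      Set.disjoint_compl_right_iff_subset.2 hMC⟩
  · have hcompl : (M ⊔ M').vertsᶜ = (C \ M.verts) \ s := by
      ext v
      simp only [SimpleGraph.Subgraph.verts_sup, hverts, Set.mem_compl_iff, Set.mem_union,
        Set.mem_sdiff]
      tauto
    rw [hcompl, Set.ncard_sdiff hs, hcard]
    lia

end Matchings

section Wheels

variable {V : Type*} {H : SimpleGraph V} {m : ℕ} {c : Fin m → V} {r : V}

/-- The hub `r` is linked to all other vertices, and among the rim vertices, listed in cyclic order
by `c`, only consecutive ones may be linked. -/
structure IsWheel (H : SimpleGraph V) (c : Fin m → V) (r : V) : Prop where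
  injective : Function.Injective c
  isUniversal : H.IsUniversal r
  consecutive : ∀ i j, H.Adj (c i) (c j) → finRotate m i = j ∨ finRotate m j = i

lemma val_finRotate (i : Fin m) :
    (finRotate m i : ℕ) = if (i : ℕ) + 1 = m then 0 else (i : ℕ) + 1 := by
  obtain _ | m := m
  · exact i.elim0
  · rw [coe_finRotate]
    exact if_congr (by rw [Fin.ext_iff, Fin.val_last, Nat.add_right_cancel_iff]) rfl rfl

lemma finRotate_finRotate_ne (hm : 3 ≤ m) (i : Fin m) : finRotate m (finRotate m i) ≠ i := by
  intro h
  have hval := congrArg Fin.val h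
  rw [val_finRotate, val_finRotate] at hval
  lia

lemma three_le_of_ncard_edgeSet_eq [Finite V] (hV : Nat.card V = m + 1)
    (hedge : H.edgeSet.ncard = 2 * m) (hm : 0 < m) : 3 ≤ m := by
  classical
  have := Fintype.ofFinite V
  have hle : 2 * m ≤ (m + 1) * m / 2 := by
    rw [← hedge, ← SimpleGraph.coe_edgeFinset, Set.ncard_coe_finset, ← Nat.add_sub_cancel m 1,
      ← hV, Nat.sub_add_cancel (by lia), ← Nat.choose_two_right, Nat.card_eq_fintype_card]
    exact H.card_edgeFinset_le_card_choose_two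
  have hmul : 4 * m ≤ (m + 1) * m := by lia
  have := Nat.le_of_mul_le_mul_right hmul hm
  lia

lemma isUniversal_of_ncard_neighborSet [Finite V]
    (h : (H.neighborSet r).ncard + 1 = Nat.card V) : H.IsUniversal r := by
  refine SimpleGraph.neighborSet_eq_compl_singleton.1 <|
    Set.eq_of_subset_of_ncard_le (H.neighborSet_subset_compl r) ?_
  have := Set.ncard_add_ncard_compl ({r} : Set V)
  rw [Set.ncard_singleton] at this
  lia

/-- The spokes and the rim links of a wheel. -/
def wheelLink (c : Fin m → V) (r : V) : Fin m ⊕ Fin m → Sym2 V :=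
  Sum.elim (fun i => s(r, c i)) fun i => s(c i, c (finRotate m i))

lemma wheelLink_injective (hm : 3 ≤ m) (hc : Function.Injective c) (hcr : ∀ i, c i ≠ r) :
    Function.Injective (wheelLink c r) := by
  rintro (i | i) (j | j) h <;>
    simp only [wheelLink, Sum.elim_inl, Sum.elim_inr, Sym2.eq_iff, hc.eq_iff, hcr, (hcr _).symm,
      false_and, and_false, or_false, true_and] at h
  · rw [h]
  · obtain h | ⟨rfl, h⟩ := h
    · rw [h.1]
    · exact absurd h (finRotate_finRotate_ne hm j)

theorem IsHalo.exists_isWheel [Finite V] (h : IsHalo H) (hV : 2 ≤ Nat.card V) :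
    ∃ (m : ℕ) (c : Fin m → V) (r : V), 3 ≤ m ∧ Nat.card V = m + 1 ∧ IsWheel H c r := by
  obtain ⟨m, c, r, hcard, hedge, hc, hcr, hrim, hdeg⟩ := h
  have hm : 3 ≤ m := three_le_of_ncard_edgeSet_eq hcard hedge (by lia)
  have hhub : H.IsUniversal r := isUniversal_of_ncard_neighborSet (by rw [hdeg, hcard])
  have hrange : Set.range (wheelLink c r) = H.edgeSet := by
    refine Set.eq_of_subset_of_ncard_le ?_ ?_ (Set.toFinite _)
    · rintro _ ⟨i | i, rfl⟩
      · exact hhub (hcr i).symm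
      · exact hrim i
    · rw [hedge, Set.ncard_range_of_injective (wheelLink_injective hm hc hcr),
        Nat.card_eq_fintype_card, Fintype.card_sum, Fintype.card_fin, two_mul]
  refine ⟨m, c, r, hm, hcard, hc, hhub, fun i j hij => ?_⟩
  obtain ⟨a | a, ha⟩ : s(c i, c j) ∈ Set.range (wheelLink c r) := hrange ▸ hij
  · rcases Sym2.eq_iff.1 ha with h | h
    · exact absurd h.1.symm (hcr i)
    · exact absurd h.1.symm (hcr j)
  · rcases Sym2.eq_iff.1 ha with ⟨h, h'⟩ | ⟨h, h'⟩
    · exact Or.inl (hc (hc h ▸ h'))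
    · exact Or.inr (hc (hc h ▸ h'))

lemma exists_isMatching_rim (hm : 4 ≤ m) (hc : Function.Injective c)
    (hchord : ∀ i j, H.Adj (c i) (c j) → finRotate m i = j ∨ finRotate m j = i) {l : ℕ}
    (hl : 2 * l ≤ m) :
    ∃ M : Hᶜ.Subgraph, M.IsMatching ∧ M.verts ⊆ Set.range c ∧ M.verts.ncard = 2 * l := by
  let p : Fin l → Fin m := fun i => ⟨i, by lia⟩
  let q : Fin l → Fin m := fun i => ⟨i + m / 2, by lia⟩
  have hp : Function.Injective (c ∘ p) := hc.comp fun i j h => by simpa [p, Fin.ext_iff] using h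
  have hq : Function.Injective (c ∘ q) := hc.comp fun i j h => by simpa [q, Fin.ext_iff] using h
  have hne : ∀ i j, p i ≠ q j := fun i j h => by
    have := congrArg Fin.val h
    dsimp only [p, q] at this
    lia
  have hdisj : Disjoint (Set.range (c ∘ p)) (Set.range (c ∘ q)) :=
    Set.disjoint_range_iff.2 fun i j h => hne i j (hc h)
  have hadj : ∀ i, Hᶜ.Adj (c (p i)) (c (q i)) := fun i => by
    refine ⟨hc.ne (hne i i), fun h => ?_⟩
    rcases hchord _ _ h with h | h <;>
    · have hval := congrArg Fin.val h
      rw [val_finRotate] at hval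
      dsimp only [p, q] at hval
      lia
  let e := (Equiv.ofInjective _ hp).symm.trans (Equiv.ofInjective _ hq)
  obtain ⟨M, hverts, hM⟩ :=
    SimpleGraph.Subgraph.IsMatching.exists_of_disjoint_sets_of_equiv (G := Hᶜ) hdisj e fun v => by
      obtain ⟨i, rfl⟩ := (Equiv.ofInjective _ hp).surjective v
      have he : e (Equiv.ofInjective _ hp i) = Equiv.ofInjective _ hq i :=
        congrArg (Equiv.ofInjective _ hq) (Equiv.symm_apply_apply (Equiv.ofInjective _ hp) i)
      rw [he]
      exact hadj i
  refine ⟨M, hM, ?_, ?_⟩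
  · rw [hverts, Set.union_subset_iff]
    exact ⟨Set.range_comp_subset_range p c, Set.range_comp_subset_range q c⟩
  · rw [hverts, Set.ncard_union_eq hdisj, Set.ncard_range_of_injective hp,
      Set.ncard_range_of_injective hq, Nat.card_eq_fintype_card, Fintype.card_fin, two_mul]

end Wheels

section CrossPairs

variable {V : Type*} [Fintype V] {g : SimpleGraph V} {C : Set V} {k : ℕ}

lemma hasKeySharing_of_rim (hC : ∀ u ∈ C, ∀ v ∉ C, gᶜ.Adj u v) {m : ℕ} {c : Fin m → V}
    (hm : 4 ≤ m) (hc : Function.Injective c) (hcC : Set.range c ⊆ C) (hCm : C.ncard = m + 1)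
    (hchord : ∀ i j, g.Adj (c i) (c j) → finRotate m i = j ∨ finRotate m j = i)
    (hCV : C.ncard < Fintype.card V) (hVC : Fintype.card V ≤ 2 * m + 1) (hk : 2 ≤ k)
    (hkV : k + 2 ≤ Fintype.card V) : HasKeySharing g k := by
  have hcompl : C.ncard + Cᶜ.ncard = Fintype.card V := by
    rw [Set.ncard_add_ncard_compl, Nat.card_eq_fintype_card]
  obtain ⟨M, hM, hMc, hMcard⟩ :=
    exists_isMatching_rim (l := (m + 1 - Cᶜ.ncard) / 2) hm hc hchord (by lia)
  have hrest : (C \ M.verts).ncard = m + 1 - 2 * ((m + 1 - Cᶜ.ncard) / 2) := by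
    rw [Set.ncard_sdiff (hMc.trans hcC), hCm, hMcard]
  obtain ⟨M', hM', hM'card⟩ :=
    exists_nearPerfect_isMatching hC hM (hMc.trans hcC) (by lia) (by lia)
  obtain ⟨u, hu⟩ : C.Nonempty := Set.nonempty_of_ncard_ne_zero (by lia)
  obtain ⟨v, hv⟩ : Cᶜ.Nonempty := Set.nonempty_of_ncard_ne_zero (by lia)
  refine hasKeySharing_of_isMatching hM' hM'card (fun x => ?_) hk hkV
  by_cases hx : x ∈ C
  · exact ⟨v, hC x hx v hv⟩
  · exact ⟨u, (hC u hu x hx).symm⟩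

/-- Two disjoint stars, one around each of the receivers outside `C`; a balanced family consists of
the leaves of either star with the center of the other. -/
lemma hasKeySharing_of_card_eq_six (hC : ∀ u ∈ C, ∀ v ∉ C, gᶜ.Adj u v) (hC4 : C.ncard = 4)
    (hV : Fintype.card V = 6) : HasKeySharing g 3 := by
  classical
  have hcompl : Cᶜ.ncard = 2 := by
    have := Set.ncard_add_ncard_compl C
    rw [Nat.card_eq_fintype_card] at this
    lia
  let e : Fin 4 ⊕ Fin 2 ≃ V :=
    (Equiv.sumCongr (Finite.equivFinOfCardEq hC4).symm
      (Finite.equivFinOfCardEq hcompl).symm).trans (Equiv.Set.sumCompl C)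
  have hcross : ∀ i j, gᶜ.Adj (e (Sum.inl i)) (e (Sum.inr j)) := fun i j =>
    hC _ (Subtype.prop _) _ ((Finite.equivFinOfCardEq hcompl).symm j).2
  let w : Fin 4 ⊕ Fin 2 → Fin 4 ⊕ Fin 2 :=
    Sum.elim ![Sum.inr 0, Sum.inr 0, Sum.inr 1, Sum.inr 1] ![Sum.inl 0, Sum.inl 2]
  let A : Fin 2 → Finset (Fin 4 ⊕ Fin 2) :=
    ![{Sum.inl 0, Sum.inl 1, Sum.inr 1}, {Sum.inl 2, Sum.inl 3, Sum.inr 0}]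
  have hA : ∀ i, Finset.card {a | i ∈ A a} = 1 := by decide
  let B : BalancedFamily (Fin 4 ⊕ Fin 2) 3 (Fin 2) :=
    { weight _ := 1 / 2
      set := A
      weight_nonneg _ := by positivity
      sum_weight := by norm_num
      le_card := by decide
      marginal i := by
        rw [Finset.sum_const, Finset.filter_congr_decidable, hA]
        norm_num }
  have hB : ∀ a i j, w i = w j → i ∈ A a → j ∈ A a := by decide
  refine ⟨fun v => e (w (e.symm v)), ⟨fun v => ?_, fun v => ?_⟩, Fin 2, inferInstance, B.map e,
    fun a i j hij => ?_⟩
  · obtain ⟨i | i, rfl⟩ := e.surjective v <;> fin_cases i <;>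
      simp [w, hcross, (hcross _ _).symm]
  · have hw : ∀ i, w (w (w i)) = w i := by decide
    simp only [Equiv.symm_apply_apply, hw]
  · simp only [BalancedFamily.map, Finset.mem_map_equiv]
    exact hB a _ _ (e.injective hij)

end CrossPairs

section Components

variable {V : Type*} {g : SimpleGraph V} {C : g.ConnectedComponent}

lemma compl_adj_of_mem_supp_of_notMem_supp {u v : V} (hu : u ∈ C.supp) (hv : v ∉ C.supp) :
    gᶜ.Adj u v :=
  ⟨ne_of_mem_of_not_mem hu hv, fun h => hv ((C.mem_supp_congr_adj h).1 hu)⟩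

lemma nbhd_subset_nbhd_of_isUniversal {r i : C} (hr : C.toSimpleGraph.IsUniversal r) :
    nbhd g (i : V) ⊆ nbhd g (r : V) := by
  rintro j hj
  have hjC : j ∈ C.supp := hj.elim (fun h => (C.mem_supp_congr_adj h).1 i.2) fun h => h ▸ i.2
  exact or_iff_not_imp_right.2 fun hjr =>
    hr (w := ⟨j, hjC⟩) (Subtype.coe_ne_coe.1 (Ne.symm hjr))

theorem hasKeySharing_of_isWheel [Fintype V] {m k : ℕ} {c : Fin m → C} {r : C}
    (hw : IsWheel C.toSimpleGraph c r) (hm : 3 ≤ m) (hCm : C.supp.ncard = m + 1)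
    (hCV : C.supp.ncard < Fintype.card V) (hkC : k < C.supp.ncard)
    (hk : (Fintype.card V + 1) / 2 ≤ k) (hexc : ¬ (C.supp.ncard = 4 ∧ Fintype.card V = 5)) :
    HasKeySharing g k := by
  have hcross : ∀ u ∈ C.supp, ∀ v ∉ C.supp, gᶜ.Adj u v :=
    fun _ hu _ hv => compl_adj_of_mem_supp_of_notMem_supp hu hv
  obtain rfl | hm := hm.eq_or_lt
  · obtain rfl : k = 3 := by lia
    exact hasKeySharing_of_card_eq_six hcross hCm (by lia)
  · exact hasKeySharing_of_rim hcross hm (c := fun i => c i)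
      (Subtype.val_injective.comp hw.injective) (Set.range_subset_iff.2 fun i => (c i).2) hCm
      (fun i j h => hw.consecutive i j h) hCV (by lia) (by lia) (by lia)

end Components

end NetworkPersuasion

open NetworkPersuasion in
theorem mainTheorem6_general {V : Type*} [Fintype V] {k : ℕ} {S : V → Type*}
    [∀ i, Infinite (S i)] {prior : State → ℝ} (hpos : ∀ ω, 0 < prior ω)
    (hsum : prior State.X + prior State.Y = 1) (hk : (Fintype.card V + 1) / 2 ≤ k)
    (hprior : prior State.X ≤ k / (Fintype.card V + k)) {g : SimpleGraph V}
    {C : g.ConnectedComponent} (hC : IsHalo C.toSimpleGraph) (hkC : k < C.supp.ncard)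
    (hCV : C.supp.ncard < Fintype.card V) (hexc : ¬ (C.supp.ncard = 4 ∧ Fintype.card V = 5)) :
    ∃ g', g < g' ∧ networkValue S prior k g < networkValue S prior k g' ∧
      networkValue S prior k g' = privateValue S prior k := by
  have hk0 : 0 < k := by lia
  have hodds : Fintype.card V * prior State.X / k ≤ prior State.Y := by
    rw [le_div_iff₀ (by positivity)] at hprior
    rw [div_le_iff₀ (by positivity)]
    linear_combination hprior - k * hsum
  have hcard : Nat.card C = C.supp.ncard := Nat.card_coe_set_eq _
  obtain ⟨m, c, r, hm, hCm, hw⟩ := hC.exists_isWheel (by lia)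
  obtain ⟨g', hgg', hg'⟩ :=
    (hasKeySharing_of_isWheel hw hm (by lia) hCV hkC hk hexc).exists_extension (S := S) hpos hk0
      hodds
  have hg : networkValue S prior k g ≤ valueBound prior k (Fintype.card V - 1) :=
    networkValue_le_valueBound_card_sub_one hpos hk0 r.2 hkC fun i hi =>
      nbhd_subset_nbhd_of_isUniversal (i := ⟨i, hi⟩) hw.isUniversal
  have hlt : networkValue S prior k g < networkValue S prior k g' :=
    hg.trans_lt ((valueBound_strictMono hpos hk0 (by lia)).trans_le hg')
  exact ⟨g', hgg'.lt_of_ne (by rintro rfl; exact hlt.false), hlt,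
    (networkValue_le_privateValue hpos k g').antisymm
      ((networkValue_le_valueBound_card hpos hk0 ⊥).trans hg')⟩

theorem mainTheorem6 (n k : ℕ) (S : Fin n → Type*) [∀ i, Countable (S i)] [∀ i, Infinite (S i)]
    (prior : NetworkPersuasion.State → ℝ)
    (hprior_pos : ∀ ω, 0 < prior ω)
    (hprior_sum : prior NetworkPersuasion.State.X + prior NetworkPersuasion.State.Y = 1)
    (hk : (n + 1) / 2 ≤ k)
    (hprior : prior NetworkPersuasion.State.X < (k : ℝ) / ((n : ℝ) + (k : ℝ)))
    (g : SimpleGraph (Fin n)) (C : g.ConnectedComponent)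
    (hC : NetworkPersuasion.IsHalo C.toSimpleGraph)
    (hkC : k < C.supp.ncard) (hCn : C.supp.ncard < n)
    (hexc : ¬ (C.supp.ncard = 4 ∧ n = 5)) :
    ∃ g' : SimpleGraph (Fin n), g < g' ∧
      NetworkPersuasion.networkValue S prior k g < NetworkPersuasion.networkValue S prior k g' ∧
      NetworkPersuasion.networkValue S prior k g' = NetworkPersuasion.privateValue S prior k :=
  mainTheorem6_general hprior_pos hprior_sum (by rwa [Fintype.card_fin])
    (by rw [Fintype.card_fin]; exact hprior.le) hC hkC (by rwa [Fintype.card_fin])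
    (by rwa [Fintype.card_fin])
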